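/- For a commutative domain $R$ with unit group $R^\times$, define the Motzkin sets $A_{R,0} := \{0\}\cup R^\times$ and, for $j\ge 1$, $A_{R,j} := A_{R,j-1}\cup\{\beta\in R : \text{every class of } R/\beta R \text{ has a representative in } A_{R,j-1}\}$. If $R$ is Euclidean, its minimal Euclidean function $\phi_R : R\setminus\{0\}\to\mathbb{N}=\{0,1,2,\dots\}$ is defined by letting $\phi_R(a)$ be the least $j$ such that $a\in A_{R,j}$; it is the pointwise minimum of all Euclidean functions $R\setminus\{0\}\to\mathbb{N}$. Let $\phi_{\mathbb{Z}[i]}$ be the minimal Euclidean function of the ring $\mathbb{Z}[i]$ of Gaussian integers. Then for every integer $k\ge 1$, $$|\phi_{\mathbb{Z}[i]}^{-1}(2k)| = 14\cdot 4^k - 14\cdot 2^k + 4 \quad\text{and}\quad |\phi_{\mathbb{Z}[i]}^{-1}(2k+1)| = 28\cdot 4^k - 20\cdot 2^k + 4.$$ -/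

import Mathlib

/-- A Euclidean function on `R`: a function `f : R ∖ {0} → ℕ` such that for all `a` and all
nonzero `b` there are `q, r` with `a = q * b + r` and either `r = 0` or `f r < f b`. -/
def IsEuclideanFunction {R : Type*} [CommRing R] (f : {a : R // a ≠ 0} → ℕ) : Prop :=
  ∀ (a : R) (b : {a : R // a ≠ 0}), ∃ q r : R, a = q * b + r ∧
    (r = 0 ∨ ∃ hr : r ≠ 0, f ⟨r, hr⟩ < f b)

/-- `G ↠ R/β`: every class of `R/β` has a representative in `G`. -/
def SurjectsOntoQuotient {R : Type*} [CommRing R] (G : Set R) (β : R) : Prop :=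
  ∀ x : R ⧸ Ideal.span {β}, ∃ r ∈ G, Ideal.Quotient.mk (Ideal.span {β}) r = x

/-- The Motzkin sets `A_{R,j}` of a commutative ring. -/
def motzkinSet (R : Type*) [CommRing R] : ℕ → Set R
  | 0 => {0} ∪ {u : R | IsUnit u}
  | j + 1 => motzkinSet R j ∪ {β : R | SurjectsOntoQuotient (motzkinSet R j) β}

/-- The minimal Euclidean function `φ_R : R ∖ {0} → ℕ`: `φ_R a` is the least `j` with
`a ∈ A_{R,j}`. (If `R` is a Euclidean domain, such a `j` exists for every `a`, and `φ_R` is the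
pointwise least Euclidean function; both facts are proved below.) -/
noncomputable def minimalEuclideanFunction (R : Type*) [CommRing R] (a : {a : R // a ≠ 0}) : ℕ :=
  sInf {j : ℕ | (a : R) ∈ motzkinSet R j}

/-- A Euclidean function bounds the Motzkin index. -/
theorem mem_motzkinSet_of_le {R : Type*} [CommRing R] {f : {a : R // a ≠ 0} → ℕ}
    (hf : IsEuclideanFunction f) (j : ℕ) (b : {a : R // a ≠ 0}) (hb : f b ≤ j) :
    (b : R) ∈ motzkinSet R j := by
  induction j generalizing b with
  | zero =>
    obtain ⟨q, r, h, hr | ⟨hr, hlt⟩⟩ := hf 1 b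
    · right
      subst hr
      exact IsUnit.of_mul_eq_one q (by rw [mul_comm, ← add_zero (q * _), ← h])
    · omega
  | succ j ih =>
    right
    intro x
    obtain ⟨a, rfl⟩ := Ideal.Quotient.mk_surjective x
    obtain ⟨q, r, h, hr⟩ := hf a b
    refine ⟨r, ?_, ?_⟩
    · rcases hr with rfl | ⟨hr, hlt⟩
      · have h0 : ∀ i, (0 : R) ∈ motzkinSet R i := by
          intro i
          induction i with
          | zero => exact Or.inl rfl
          | succ i ih => exact Or.inl ih
        exact h0 j
      · exact ih ⟨r, hr⟩ (by omega)
    · rw [eq_comm, Ideal.Quotient.eq, Ideal.mem_span_singleton]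
      exact ⟨q, by rw [h]; ring⟩

/-- On a ring with a Euclidean function, the Motzkin sets exhaust the ring, so that
`minimalEuclideanFunction` is given by `a ∈ A_j ∖ A_{j-1}`. -/
theorem minimalEuclideanFunction_le_iff {R : Type*} [CommRing R] {f : {a : R // a ≠ 0} → ℕ}
    (hf : IsEuclideanFunction f) (a : {a : R // a ≠ 0}) (j : ℕ) :
    minimalEuclideanFunction R a ≤ j ↔ (a : R) ∈ motzkinSet R j := by
  have hmono : Monotone (motzkinSet R) := monotone_nat_of_le_succ fun n => Set.subset_union_left
  have hne : {j : ℕ | (a : R) ∈ motzkinSet R j}.Nonempty :=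
    ⟨f a, mem_motzkinSet_of_le hf _ a le_rfl⟩
  exact ⟨fun h => hmono h (Nat.sInf_mem hne), fun h => Nat.sInf_le h⟩

/-- `minimalEuclideanFunction` lies below every Euclidean function. -/
theorem minimalEuclideanFunction_le {R : Type*} [CommRing R] {f : {a : R // a ≠ 0} → ℕ}
    (hf : IsEuclideanFunction f) (a : {a : R // a ≠ 0}) : minimalEuclideanFunction R a ≤ f a :=
  (minimalEuclideanFunction_le_iff hf a _).2 (mem_motzkinSet_of_le hf _ a le_rfl)

/-- `minimalEuclideanFunction` is a Euclidean function as soon as there is one. -/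
theorem isEuclideanFunction_minimalEuclideanFunction {R : Type*} [CommRing R]
    {f : {a : R // a ≠ 0} → ℕ} (hf : IsEuclideanFunction f) :
    IsEuclideanFunction (minimalEuclideanFunction R) := by
  intro a b
  have hb := (minimalEuclideanFunction_le_iff hf b _).1 le_rfl
  rcases hj : minimalEuclideanFunction R b with _ | j
  · rw [hj] at hb
    rcases hb with hb | hb
    · exact absurd hb b.2
    · obtain ⟨u, hu⟩ := hb
      exact ⟨a * (↑u⁻¹ : R), 0, by rw [← hu]; simp, Or.inl rfl⟩
  · rw [hj] at hb
    rcases hb with hb | hb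
    · have := (minimalEuclideanFunction_le_iff hf b j).2 hb
      omega
    · obtain ⟨r, hr, hx⟩ := hb (Ideal.Quotient.mk _ a)
      rw [eq_comm, Ideal.Quotient.eq, Ideal.mem_span_singleton] at hx
      obtain ⟨q, hq⟩ := hx
      refine ⟨q, r, by linear_combination hq, ?_⟩
      by_cases h0 : r = 0
      · exact Or.inl h0
      · have := (minimalEuclideanFunction_le_iff hf ⟨r, h0⟩ j).2 hr
        exact Or.inr ⟨h0, by omega⟩

/-- The norm is a Euclidean function on the Gaussian integers, so the facts above apply to them. -/
theorem isEuclideanFunction_gaussianInt_norm :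
    IsEuclideanFunction (fun a : {a : GaussianInt // a ≠ 0} => (Zsqrtd.norm a.1).natAbs) := by
  intro a b
  refine ⟨a / b, a % b, ?_, ?_⟩
  · rw [mul_comm]; exact (EuclideanDomain.div_add_mod a (b : GaussianInt)).symm
  · by_cases h : a % (b : GaussianInt) = 0
    · exact Or.inl h
    · exact Or.inr ⟨h, GaussianInt.natAbs_norm_mod_lt a b.2⟩

/-! The Motzkin sets of `ℤ[i]` are computed exactly and then counted. Write w_n for `octWidth n`.
The claim `motzkinSet_gaussianInt` is that A_n consists of 0 and the 2^j y with y not divisible by 2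
and y in the octagon of index n - 2j. Both w_{n+2} = 2 w_n and (1+i)^2 = 2i say that two steps of
the construction amount to a doubling, so most arguments descend from n + 2 to n.

Upper bound (`mem_octSet_succ_of_surjects`): if `octSet n` meets every class mod b, let r in it
represent -(1+i)^(n+1). Then b divides r + (1+i)^(n+1), which is nonzero and lies in `octSet (n +
1)`; since that set contains the divisors of its nonzero elements, b lies in it.

Lower bound (`exists_sub_mul_mem_octSet`): reduce z mod b to r in the square spanned by b and ib. If
r is not divisible by 2, the size bounds place it in the octagon. If r and b are both divisible by
2, halve both and recurse. If only r is, either r is already in `octSet n`, or it is so close to the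
boundary that r - ub lies in the octagon for some unit u; this difference is again not divisible by
2.

Counting: the points of an octagon not divisible by 2 are all its points minus the doubles of a
half-size octagon. Summing over the layers 2^j gives |A_n \ {0}|, and differences of consecutive
terms give the fibers. -/

/-! ### Octagons and the candidate sets -/

/-- The sequence `3, 4, 6, 8, 12, 16, …` measuring the octagons. -/
def octWidth : ℕ → ℤ
  | 0 => 3
  | 1 => 4
  | n + 2 => 2 * octWidth n

theorem octWidth_add_two (n : ℕ) : octWidth (n + 2) = 2 * octWidth n := rfl

theorem octWidth_two_mul (k : ℕ) : octWidth (2 * k) = 3 * 2 ^ k := by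
  induction k with
  | zero => rfl
  | succ k ih => rw [show 2 * (k + 1) = 2 * k + 2 by ring, octWidth_add_two, ih]; ring

theorem octWidth_two_mul_add_one (k : ℕ) : octWidth (2 * k + 1) = 4 * 2 ^ k := by
  induction k with
  | zero => rfl
  | succ k ih => rw [show 2 * (k + 1) + 1 = (2 * k + 1) + 2 by ring, octWidth_add_two, ih]; ring

theorem octWidth_cases (n : ℕ) : ∃ k : ℕ,
    (octWidth n = 3 * 2 ^ k ∧ octWidth (n + 1) = 4 * 2 ^ k) ∨
    (octWidth n = 4 * 2 ^ k ∧ octWidth (n + 1) = 6 * 2 ^ k) := by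
  rcases Nat.even_or_odd' n with ⟨k, rfl | rfl⟩
  · exact ⟨k, Or.inl ⟨octWidth_two_mul k, octWidth_two_mul_add_one k⟩⟩
  · refine ⟨k, Or.inr ⟨octWidth_two_mul_add_one k, ?_⟩⟩
    rw [octWidth_add_two, octWidth_two_mul]; ring

theorem octWidth_bounds (n : ℕ) : 3 ≤ octWidth n ∧ octWidth n < octWidth (n + 1) ∧
    octWidth (n + 1) < 2 * octWidth n ∧ 2 ∣ octWidth (n + 1) := by
  obtain ⟨k, h⟩ := octWidth_cases n
  have : (1 : ℤ) ≤ 2 ^ k := one_le_pow₀ (by norm_num)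
  omega

/-- The integer points of the octagon `|x|, |y| ≤ w_n - 2`, `|x| + |y| ≤ w_{n+1} - 3`. -/
def octagon (n : ℕ) : Set GaussianInt :=
  {z | |z.re| ≤ octWidth n - 2 ∧ |z.im| ≤ octWidth n - 2 ∧
    |z.re| + |z.im| ≤ octWidth (n + 1) - 3}

/-- The Gaussian integers not divisible by `2`. -/
def notDivTwo : Set GaussianInt := {z | ¬ (2 ∣ z.re ∧ 2 ∣ z.im)}

/-- The explicit description of the Motzkin sets of `ℤ[i]`. -/
def octSet : ℕ → Set GaussianInt
  | 0 => {0} ∪ (notDivTwo ∩ octagon 0)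
  | 1 => {0} ∪ (notDivTwo ∩ octagon 1)
  | n + 2 => (notDivTwo ∩ octagon (n + 2)) ∪ (fun z => 2 * z) '' octSet n

theorem re_two_mul (z : GaussianInt) : (2 * z).re = 2 * z.re := by
  simp [Zsqrtd.re_mul]

theorem im_two_mul (z : GaussianInt) : (2 * z).im = 2 * z.im := by
  simp [Zsqrtd.im_mul]

theorem exists_eq_two_mul {z : GaussianInt} (h : z ∉ notDivTwo) : ∃ y, z = 2 * y := by
  simp only [notDivTwo, Set.mem_ofPred_eq, not_not] at h
  obtain ⟨⟨a, ha⟩, b, hb⟩ := h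
  exact ⟨⟨a, b⟩, by ext <;> simp [ha, hb]⟩

theorem two_mul_notMem_notDivTwo (z : GaussianInt) : 2 * z ∉ notDivTwo := by
  simp [notDivTwo]

theorem ne_zero_of_mem_notDivTwo {z : GaussianInt} (h : z ∈ notDivTwo) : z ≠ 0 := by
  rintro rfl
  simp [notDivTwo] at h

theorem two_mul_injective : Function.Injective (fun z : GaussianInt => 2 * z) :=
  mul_right_injective₀ two_ne_zero

theorem zero_mem_octSet (n : ℕ) : (0 : GaussianInt) ∈ octSet n := by
  induction n using Nat.twoStepInduction with
  | zero => exact Or.inl rfl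
  | one => exact Or.inl rfl
  | more n ih _ => exact Or.inr ⟨0, ih, mul_zero _⟩

theorem mem_octSet_of_mem_octagon {n : ℕ} {z : GaussianInt} (h : z ∈ notDivTwo)
    (hz : z ∈ octagon n) : z ∈ octSet n := by
  rcases n with _ | _ | n
  · exact Or.inr ⟨h, hz⟩
  · exact Or.inr ⟨h, hz⟩
  · exact Or.inl ⟨h, hz⟩

theorem two_mul_mem_octSet_iff {n : ℕ} {z : GaussianInt} :
    2 * z ∈ octSet (n + 2) ↔ z ∈ octSet n := by
  constructor
  · rintro (h | ⟨y, hy, h⟩)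
    · exact absurd h.1 (two_mul_notMem_notDivTwo z)
    · exact two_mul_injective h ▸ hy
  · exact fun h => Or.inr ⟨z, h, rfl⟩

theorem eq_zero_of_two_mul_mem_octSet {n : ℕ} (hn : n < 2) {z : GaussianInt}
    (h : 2 * z ∈ octSet n) : z = 0 := by
  have h' : 2 * z = 0 := by
    interval_cases n
    · exact h.resolve_right fun h => two_mul_notMem_notDivTwo z h.1
    · exact h.resolve_right fun h => two_mul_notMem_notDivTwo z h.1
  simpa using h'

theorem octSet_subset_octagon (n : ℕ) : octSet n ⊆ octagon n := by
  have h0 : ∀ n, (0 : GaussianInt) ∈ octagon n := by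
    intro n
    have := octWidth_bounds n
    simp only [octagon, Set.mem_ofPred_eq, Zsqrtd.re_zero, Zsqrtd.im_zero, abs_zero]
    omega
  induction n using Nat.twoStepInduction with
  | zero => rintro z (rfl | h); exacts [h0 _, h.2]
  | one => rintro z (rfl | h); exacts [h0 _, h.2]
  | more n ih _ =>
    rintro z (h | ⟨y, hy, rfl⟩)
    · exact h.2
    · obtain ⟨h1, h2, h3⟩ := ih hy
      simp only [octagon, Set.mem_ofPred_eq, re_two_mul, im_two_mul, abs_mul, abs_two]
      have e1 := octWidth_add_two n
      have e2 := octWidth_add_two (n + 1)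
      rw [show n + 2 + 1 = n + 1 + 2 by ring]
      omega

theorem octagon_mono {n : ℕ} : octagon n ⊆ octagon (n + 1) := by
  rintro z ⟨h1, h2, h3⟩
  have := octWidth_bounds n
  have := octWidth_bounds (n + 1)
  exact ⟨by omega, by omega, by omega⟩

theorem octSet_mono (n : ℕ) : octSet n ⊆ octSet (n + 1) := by
  induction n using Nat.twoStepInduction with
  | zero =>
    rintro z (rfl | h)
    exacts [zero_mem_octSet _, mem_octSet_of_mem_octagon h.1 (octagon_mono h.2)]
  | one =>
    rintro z (rfl | h)
    exacts [zero_mem_octSet _, mem_octSet_of_mem_octagon h.1 (octagon_mono h.2)]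
  | more n ih _ =>
    rintro z (h | ⟨y, hy, rfl⟩)
    · exact mem_octSet_of_mem_octagon h.1 (octagon_mono h.2)
    · exact two_mul_mem_octSet_iff.2 (ih hy)

/-- The inequalities are those of the octagon of index n - 2j multiplied by 2^j, since w_n = 2^j
w_{n-2j}. Stated this way they also make sense for n < 2j, where no z satisfies them. -/
theorem two_pow_mul_mem_octSet (j : ℕ) : ∀ (n : ℕ) (z : GaussianInt), z ∈ notDivTwo →
    2 ^ j * |z.re| ≤ octWidth n - 2 * 2 ^ j → 2 ^ j * |z.im| ≤ octWidth n - 2 * 2 ^ j →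
    2 ^ j * (|z.re| + |z.im|) ≤ octWidth (n + 1) - 3 * 2 ^ j → 2 ^ j * z ∈ octSet n := by
  induction j with
  | zero =>
    intro n z hz h1 h2 h3
    simp only [pow_zero, one_mul, mul_one] at *
    exact mem_octSet_of_mem_octagon hz ⟨h1, h2, h3⟩
  | succ j ih =>
    intro n z hz h1 h2 h3
    have hj : (1 : ℤ) ≤ 2 ^ j := one_le_pow₀ (by norm_num)
    rcases n with _ | _ | n
    · have := mul_nonneg (show (0 : ℤ) ≤ 2 ^ (j + 1) by positivity) (abs_nonneg z.re)
      simp only [octWidth] at *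
      rw [pow_succ] at *
      omega
    -- Here w_1 = 4 leaves room only for z = 0, which is divisible by 2.
    · exfalso
      have e1 := mul_nonneg (show (0 : ℤ) ≤ 2 ^ (j + 1) by positivity) (abs_nonneg z.re)
      have e2 := mul_nonneg (show (0 : ℤ) ≤ 2 ^ (j + 1) by positivity) (abs_nonneg z.im)
      simp only [octWidth] at h1 h2
      have hp : (2 : ℤ) ^ (j + 1) = 2 * 2 ^ j := pow_succ' _ _
      have f1 : 2 ^ (j + 1) * |z.re| = 0 := by omega
      have f2 : 2 ^ (j + 1) * |z.im| = 0 := by omega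
      have g1 : z.re = 0 := by simpa using f1
      have g2 : z.im = 0 := by simpa using f2
      exact ne_zero_of_mem_notDivTwo hz (by ext <;> simp [g1, g2])
    · rw [pow_succ', mul_assoc, two_mul_mem_octSet_iff]
      rw [show n + 2 + 1 = n + 1 + 2 by ring] at h3
      rw [octWidth_add_two, pow_succ', mul_assoc] at h1 h2 h3
      exact ih n z hz (by omega) (by omega) (by omega)

/-! ### Units, norms and closure under divisors -/

theorem norm_eq_sq_add_sq (z : GaussianInt) : Zsqrtd.norm z = z.re ^ 2 + z.im ^ 2 := by
  rw [Zsqrtd.norm_def]; ring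

theorem abs_add_abs_eq_one_iff (x y : ℤ) :
    |x| + |y| = 1 ↔ (x = 1 ∧ y = 0) ∨ (x = -1 ∧ y = 0) ∨ (x = 0 ∧ y = 1) ∨ (x = 0 ∧ y = -1) := by
  rcases abs_cases x with h | h <;> rcases abs_cases y with h' | h' <;> omega

theorem gaussianInt_isUnit_iff (z : GaussianInt) : IsUnit z ↔ |z.re| + |z.im| = 1 := by
  rw [← Zsqrtd.norm_eq_one_iff' (by norm_num), norm_eq_sq_add_sq]
  constructor
  · intro h
    have h1 : |z.re| ≤ 1 := abs_le_one_iff_mul_self_le_one.2 (by nlinarith)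
    have h2 : |z.im| ≤ 1 := abs_le_one_iff_mul_self_le_one.2 (by nlinarith)
    rw [← sq_abs z.re, ← sq_abs z.im] at h
    have := abs_nonneg z.re
    have := abs_nonneg z.im
    generalize |z.re| = x at *
    generalize |z.im| = y at *
    interval_cases x <;> interval_cases y <;> simp_all
  · rw [abs_add_abs_eq_one_iff]
    rintro (⟨h, h'⟩ | ⟨h, h'⟩ | ⟨h, h'⟩ | ⟨h, h'⟩) <;> simp [h, h']

theorem gaussianInt_isUnit_cases {u : GaussianInt} (h : IsUnit u) :
    u = ⟨1, 0⟩ ∨ u = ⟨-1, 0⟩ ∨ u = ⟨0, 1⟩ ∨ u = ⟨0, -1⟩ := by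
  rw [gaussianInt_isUnit_iff, abs_add_abs_eq_one_iff] at h
  simpa only [Zsqrtd.ext_iff] using h

theorem mem_octSet_zero_iff (z : GaussianInt) : z ∈ octSet 0 ↔ z = 0 ∨ IsUnit z := by
  rw [gaussianInt_isUnit_iff]
  simp only [octSet, octagon, notDivTwo, octWidth, Set.mem_union, Set.mem_singleton_iff,
    Set.mem_inter_iff, Set.mem_ofPred_eq, Zsqrtd.ext_iff, Zsqrtd.re_zero, Zsqrtd.im_zero]
  rcases abs_cases z.re with h | h <;> rcases abs_cases z.im with h' | h' <;> omega

theorem unit_mul_mem_octagon {n : ℕ} {u z : GaussianInt} (hu : IsUnit u) :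
    u * z ∈ octagon n ↔ z ∈ octagon n := by
  rcases gaussianInt_isUnit_cases hu with rfl | rfl | rfl | rfl <;>
    simp [octagon, Zsqrtd.re_mul, Zsqrtd.im_mul] <;> omega

theorem unit_mul_mem_notDivTwo {u z : GaussianInt} (hu : IsUnit u) :
    u * z ∈ notDivTwo ↔ z ∈ notDivTwo := by
  rcases gaussianInt_isUnit_cases hu with rfl | rfl | rfl | rfl <;>
    simp [notDivTwo, Zsqrtd.re_mul, Zsqrtd.im_mul] <;> omega

/-- A convex function is maximal at a vertex, here (w_n - 2, w_{n+1} - w_n - 1). -/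
theorem sq_add_sq_le_of_mem_octagon {n : ℕ} {z : GaussianInt} (h : z ∈ octagon n) :
    z.re ^ 2 + z.im ^ 2 ≤
      (octWidth n - 2) ^ 2 + (octWidth (n + 1) - octWidth n - 1) ^ 2 := by
  obtain ⟨h1, h2, h3⟩ := h
  have := octWidth_bounds n
  rw [← sq_abs z.re, ← sq_abs z.im]
  have hx := abs_nonneg z.re
  have hy := abs_nonneg z.im
  generalize |z.re| = x at *
  generalize |z.im| = y at *
  generalize octWidth n = W at *
  generalize octWidth (n + 1) = V at *
  obtain ⟨a, rfl⟩ : ∃ a, W = a + 2 := ⟨W - 2, by ring⟩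
  obtain ⟨b, rfl⟩ : ∃ b, V = a + b + 3 := ⟨V - a - 3, by ring⟩
  by_cases hyb : y ≤ b
  · nlinarith
  · by_cases hxb : x ≤ b
    · nlinarith
    · nlinarith

theorem le_sq_add_sq_of_notMem_octagon {n : ℕ} {z : GaussianInt} (h : z ∉ octagon n) :
    2 * (octWidth n - 1) ^ 2 ≤ 2 * (z.re ^ 2 + z.im ^ 2) ∨
      (octWidth (n + 1) - 2) ^ 2 ≤ 2 * (z.re ^ 2 + z.im ^ 2) := by
  have := octWidth_bounds n
  rw [← sq_abs z.re, ← sq_abs z.im]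
  simp only [octagon, Set.mem_ofPred_eq] at h
  have hx := abs_nonneg z.re
  have hy := abs_nonneg z.im
  generalize |z.re| = x at *
  generalize |z.im| = y at *
  generalize octWidth n = W at *
  generalize octWidth (n + 1) = V at *
  by_cases h1 : x ≤ W - 2
  · by_cases h2 : y ≤ W - 2
    · right
      have : V - 2 ≤ x + y := by omega
      nlinarith [sq_nonneg (x - y)]
    · left
      have : W - 1 ≤ y := by omega
      nlinarith
  · left
    have : W - 1 ≤ x := by omega
    nlinarith

/-- A nonunit factor at least doubles the norm, while the largest norm inside the octagon is less
than twice the smallest norm outside. -/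
theorem mem_octagon_of_mul_mem {n : ℕ} {q b : GaussianInt} (hq : q ≠ 0)
    (h : q * b ∈ octagon n) : b ∈ octagon n := by
  by_cases hu : IsUnit q
  · exact (unit_mul_mem_octagon hu).1 h
  by_contra hb
  have hN := sq_add_sq_le_of_mem_octagon h
  rw [← norm_eq_sq_add_sq, Zsqrtd.norm_mul, norm_eq_sq_add_sq b] at hN
  have hq0 : 0 < Zsqrtd.norm q := GaussianInt.norm_pos.2 hq
  have hq1 : Zsqrtd.norm q ≠ 1 := fun h => hu ((Zsqrtd.norm_eq_one_iff' (by norm_num) q).1 h)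
  have hq2 : 2 ≤ Zsqrtd.norm q := by omega
  have hb0 : 0 ≤ b.re ^ 2 + b.im ^ 2 := by positivity
  have hle : 2 * (b.re ^ 2 + b.im ^ 2) ≤ Zsqrtd.norm q * (b.re ^ 2 + b.im ^ 2) :=
    mul_le_mul_of_nonneg_right hq2 hb0
  have hout := le_sq_add_sq_of_notMem_octagon hb
  obtain ⟨k, hk⟩ := octWidth_cases n
  have ht : (1 : ℤ) ≤ 2 ^ k := one_le_pow₀ (by norm_num)
  generalize (2 : ℤ) ^ k = t at *
  rcases hk with ⟨e1, e2⟩ | ⟨e1, e2⟩ <;> rw [e1, e2] at hN hout <;> rcases hout with h | h <;>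
    nlinarith

/-- `octSet n` contains the divisors of its nonzero elements. -/
theorem mem_octSet_of_mul_mem {n : ℕ} {q b : GaussianInt} (hqb : q * b ≠ 0)
    (h : q * b ∈ octSet n) : b ∈ octSet n := by
  induction n using Nat.strong_induction_on generalizing b with
  | _ n ih =>
  by_cases hb : b ∈ notDivTwo
  · exact mem_octSet_of_mem_octagon hb
      (mem_octagon_of_mul_mem (left_ne_zero_of_mul hqb) (octSet_subset_octagon n h))
  · obtain ⟨c, rfl⟩ := exists_eq_two_mul hb
    rw [mul_left_comm] at h hqb
    rcases lt_or_ge n 2 with hn | hn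
    · exact absurd (eq_zero_of_two_mul_mem_octSet hn h) (right_ne_zero_of_mul hqb)
    · obtain ⟨m, rfl⟩ := Nat.exists_eq_add_of_le' hn
      rw [two_mul_mem_octSet_iff] at h ⊢
      exact ih m (by omega) (right_ne_zero_of_mul hqb) h

/-! ### Translation by powers of 1 + i: the upper bound -/

theorem one_add_I_sq : (⟨1, 1⟩ : GaussianInt) ^ 2 = 2 * ⟨0, 1⟩ := by
  ext <;> simp [pow_two, Zsqrtd.re_mul, Zsqrtd.im_mul]

theorem isUnit_I : IsUnit (⟨0, 1⟩ : GaussianInt) := by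
  simp [gaussianInt_isUnit_iff]

theorem unit_mul_one_add_I_pow_add_two (u : GaussianInt) (n : ℕ) :
    u * ⟨1, 1⟩ ^ (n + 2) = 2 * (u * ⟨0, 1⟩ * ⟨1, 1⟩ ^ n) := by
  rw [pow_add, one_add_I_sq]; ring

/-- The right-hand sides are the gaps between the octagons of index n and n + 1, so translation by
this element carries the first into the second. -/
theorem unit_mul_one_add_I_pow_bounds (n : ℕ) {u : GaussianInt} (hu : IsUnit u) :
    |(u * ⟨1, 1⟩ ^ (n + 1)).re| ≤ octWidth (n + 1) - octWidth n ∧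
    |(u * ⟨1, 1⟩ ^ (n + 1)).im| ≤ octWidth (n + 1) - octWidth n ∧
    |(u * ⟨1, 1⟩ ^ (n + 1)).re| + |(u * ⟨1, 1⟩ ^ (n + 1)).im| ≤
      octWidth (n + 2) - octWidth (n + 1) := by
  induction n using Nat.twoStepInduction generalizing u with
  | zero =>
    rcases gaussianInt_isUnit_cases hu with rfl | rfl | rfl | rfl <;>
      simp [Zsqrtd.re_mul, Zsqrtd.im_mul, octWidth]
  | one =>
    rcases gaussianInt_isUnit_cases hu with rfl | rfl | rfl | rfl <;>
      simp [Zsqrtd.re_mul, Zsqrtd.im_mul, octWidth, one_add_I_sq]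
  | more n ih _ =>
    rw [show n + 2 + 1 = n + 1 + 2 by ring, unit_mul_one_add_I_pow_add_two]
    have := ih (hu.mul isUnit_I)
    simp only [re_two_mul, im_two_mul, abs_mul, abs_two]
    rw [octWidth_add_two (n + 1), octWidth_add_two n, octWidth_add_two (n + 2)]
    omega

theorem unit_mul_one_add_I_pow_notMem_octSet (n : ℕ) {u : GaussianInt} (hu : IsUnit u) :
    u * ⟨1, 1⟩ ^ (n + 1) ∉ octSet n := by
  induction n using Nat.twoStepInduction generalizing u with
  | zero =>
    rw [mem_octSet_zero_iff, gaussianInt_isUnit_iff]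
    rcases gaussianInt_isUnit_cases hu with rfl | rfl | rfl | rfl <;>
      simp [Zsqrtd.re_mul, Zsqrtd.im_mul, Zsqrtd.ext_iff]
  | one =>
    rw [unit_mul_one_add_I_pow_add_two]
    intro h
    have := eq_zero_of_two_mul_mem_octSet one_lt_two h
    rw [pow_zero, mul_one] at this
    exact (hu.mul isUnit_I).ne_zero this
  | more n ih _ =>
    rw [show n + 2 + 1 = n + 1 + 2 by ring, unit_mul_one_add_I_pow_add_two,
      two_mul_mem_octSet_iff]
    exact ih (hu.mul isUnit_I)

theorem add_two_mul_mem_notDivTwo {r z : GaussianInt} (h : r ∈ notDivTwo) :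
    r + 2 * z ∈ notDivTwo := by
  simp only [notDivTwo, Set.mem_ofPred_eq, Zsqrtd.re_add, Zsqrtd.im_add, re_two_mul,
    im_two_mul] at *
  omega

theorem add_unit_mul_one_add_I_pow_mem_octagon {n : ℕ} {r u : GaussianInt} (hu : IsUnit u)
    (hr : r ∈ octagon n) : r + u * ⟨1, 1⟩ ^ (n + 1) ∈ octagon (n + 1) := by
  obtain ⟨h1, h2, h3⟩ := hr
  obtain ⟨g1, g2, g3⟩ := unit_mul_one_add_I_pow_bounds n hu
  refine ⟨?_, ?_, ?_⟩ <;> simp only [Zsqrtd.re_add, Zsqrtd.im_add]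
  · have := abs_add_le r.re (u * ⟨1, 1⟩ ^ (n + 1)).re
    omega
  · have := abs_add_le r.im (u * ⟨1, 1⟩ ^ (n + 1)).im
    omega
  · have := abs_add_le r.re (u * ⟨1, 1⟩ ^ (n + 1)).re
    have := abs_add_le r.im (u * ⟨1, 1⟩ ^ (n + 1)).im
    rw [show n + 1 + 1 = n + 2 by ring]
    omega

/-- For n ≥ 1 the added term is divisible by 2: it preserves non-divisibility of r, and if r is also
divisible by 2 both terms can be halved. The small cases are checked by hand. -/
theorem add_unit_mul_one_add_I_pow_mem_octSet (n : ℕ) {r u : GaussianInt} (hu : IsUnit u)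
    (hr : r ∈ octSet n) : r + u * ⟨1, 1⟩ ^ (n + 1) ∈ octSet (n + 1) := by
  induction n using Nat.twoStepInduction generalizing r u with
  | zero =>
    refine mem_octSet_of_mem_octagon ?_
      (add_unit_mul_one_add_I_pow_mem_octagon hu (octSet_subset_octagon _ hr))
    rw [mem_octSet_zero_iff] at hr
    rcases hr with rfl | hr
    · rcases gaussianInt_isUnit_cases hu with rfl | rfl | rfl | rfl <;>
        simp [Zsqrtd.re_mul, Zsqrtd.im_mul, notDivTwo]
    · rcases gaussianInt_isUnit_cases hu with rfl | rfl | rfl | rfl <;>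
      rcases gaussianInt_isUnit_cases hr with rfl | rfl | rfl | rfl <;>
        simp [Zsqrtd.re_mul, Zsqrtd.im_mul, notDivTwo]
  | one =>
    rcases hr with rfl | hr
    · rw [zero_add, unit_mul_one_add_I_pow_add_two, two_mul_mem_octSet_iff, mem_octSet_zero_iff,
        pow_zero, mul_one]
      exact Or.inr (hu.mul isUnit_I)
    · refine mem_octSet_of_mem_octagon ?_ (add_unit_mul_one_add_I_pow_mem_octagon hu hr.2)
      rw [unit_mul_one_add_I_pow_add_two]
      exact add_two_mul_mem_notDivTwo hr.1
  | more n ih _ =>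
    rcases hr with hr | ⟨s, hs, rfl⟩
    · refine mem_octSet_of_mem_octagon ?_ (add_unit_mul_one_add_I_pow_mem_octagon hu hr.2)
      rw [show n + 2 + 1 = n + 1 + 2 by ring, unit_mul_one_add_I_pow_add_two]
      exact add_two_mul_mem_notDivTwo hr.1
    · rw [show n + 2 + 1 = n + 1 + 2 by ring, unit_mul_one_add_I_pow_add_two]
      simp only [← mul_add]
      rw [two_mul_mem_octSet_iff]
      exact ih (hu.mul isUnit_I) hs

theorem mem_octSet_succ_of_surjects {n : ℕ} {b : GaussianInt}
    (h : SurjectsOntoQuotient (octSet n) b) : b ∈ octSet (n + 1) := by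
  obtain ⟨r, hr, hx⟩ := h (Ideal.Quotient.mk _ (-(1 * ⟨1, 1⟩ ^ (n + 1))))
  rw [Ideal.Quotient.eq, Ideal.mem_span_singleton, sub_neg_eq_add] at hx
  obtain ⟨q, hq⟩ := hx
  have hm := add_unit_mul_one_add_I_pow_mem_octSet n isUnit_one hr
  rw [hq, mul_comm] at hm
  refine mem_octSet_of_mul_mem ?_ hm
  rw [mul_comm, ← hq]
  intro h0
  -- If the sum vanished, r itself would be -(1+i)^(n+1), which is not in `octSet n`.
  refine unit_mul_one_add_I_pow_notMem_octSet n (u := -1) isUnit_one.neg ?_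
  rwa [neg_mul, ← eq_neg_of_add_eq_zero_left h0]

/-! ### Reduction modulo an element: the lower bound -/

theorem abs_bounds_of_linear {x y M L : ℤ} (h1 : x ≤ M) (h2 : -x ≤ M) (h3 : y ≤ M) (h4 : -y ≤ M)
    (h5 : x + y ≤ L) (h6 : x - y ≤ L) (h7 : -x + y ≤ L) (h8 : -x - y ≤ L) :
    |x| ≤ M ∧ |y| ≤ M ∧ |x| + |y| ≤ L := by
  rcases abs_cases x with h | h <;> rcases abs_cases y with h' | h' <;> omega

theorem eq_of_dvd_sub_of_lt {P m n : ℤ} (h : P ∣ m - n) (h1 : m - n < P) (h2 : n - m < P) :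
    m = n := by
  have := Int.eq_zero_of_abs_lt_dvd h (abs_lt.2 ⟨by omega, by omega⟩)
  omega

/-- If `r = x + iy` is near the boundary of the octagon, then `r - β` or `r - iβ` lies in the
octagon, where `β = a + ib`: the case where `β` and `r` lie in fixed sectors. -/
theorem sub_mem_octagon_of_sector {W V P a b x y : ℤ} (hb : 0 ≤ b) (hba : b ≤ a) (hx : -y ≤ x)
    (hxy : x ≤ y) (hP : 2 ≤ P) (ha : a ≤ V - 2) (hab : a + b ≤ 2 * W - 3)
    (hpar : ¬ 2 ∣ a + b ∨ a ≤ V - 3) (h2x : 2 ∣ x) (h2y : 2 ∣ y) (h2V : 2 ∣ V)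
    (hsq : 2 * y ≤ a + b) (hsum : x + y ≤ a) (hsum' : y - x ≤ a) (hW : W + P ≤ V)
    (hV : V + P ≤ 2 * W) (hV' : V + 2 * P ≤ 2 * W ∨ W = 2 * P) (hPW : P ∣ W) (hPV : P ∣ V)
    (hPx : P ∣ x) (hPy : P ∣ y) (hr : W - 2 * P < y ∨ V - 3 * P < x + y ∨ V - 3 * P < y - x) :
    (|x - a| ≤ W - 2 ∧ |y - b| ≤ W - 2 ∧ |x - a| + |y - b| ≤ V - 3) ∨
    (|x + b| ≤ W - 2 ∧ |y - a| ≤ W - 2 ∧ |x + b| + |y - a| ≤ V - 3) := by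
  by_cases h1 : W - 2 * P < y
  · have hy : y = W - P :=
      eq_of_dvd_sub_of_lt (dvd_sub hPy (dvd_sub hPW dvd_rfl)) (by omega) (by omega)
    by_cases ho : a - x ≤ W - 2 ∧ a - x + y - b ≤ V - 3 ∧ a - x - y + b ≤ V - 3
    · left
      apply abs_bounds_of_linear <;> omega
    · right
      by_cases hm : a - x ≤ W - 2
      · apply abs_bounds_of_linear <;> omega
      -- Here x < V - W, and both sides are multiples of P.
      · have hxle : x ≤ V - W - P := by
          by_contra hlt
          have : x = V - W :=
            eq_of_dvd_sub_of_lt (dvd_sub hPx (dvd_sub hPV hPW)) (by omega) (by omega)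
          omega
        apply abs_bounds_of_linear <;> omega
  -- If W = 2P, then y ≤ 0, so x = y = 0, against `hr` since V ≥ 3P.
  · have hV2 : V + 2 * P ≤ 2 * W := by omega
    by_cases hx0 : 0 ≤ x
    · have hs : V - 2 * P ≤ x + y := by
        by_contra hlt
        have : x + y = V - 2 * P := eq_of_dvd_sub_of_lt
          (dvd_sub (dvd_add hPx hPy) (dvd_sub hPV (dvd_mul_left _ _))) (by omega) (by omega)
        omega
      by_cases ho : a - b + y - x ≤ V - 3
      · left
        apply abs_bounds_of_linear <;> omega
      · right
        apply abs_bounds_of_linear <;> omega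
    · right
      have hs : V - 2 * P ≤ y - x := by
        by_contra hlt
        have : y - x = V - 2 * P := eq_of_dvd_sub_of_lt
          (dvd_sub (dvd_sub hPy hPx) (dvd_sub hPV (dvd_mul_left _ _))) (by omega) (by omega)
        omega
      apply abs_bounds_of_linear <;> omega

theorem exists_mul_sub_abs_le (m : ℤ) {N : ℤ} (hN : 0 < N) : ∃ q, 2 * |m - q * N| ≤ N := by
  refine ⟨(2 * m + N) / (2 * N), ?_⟩
  have h1 := Int.emod_add_mul_ediv (2 * m + N) (2 * N)
  have h2 := Int.emod_nonneg (2 * m + N) (show 2 * N ≠ 0 by omega)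
  have h3 := Int.emod_lt_of_pos (2 * m + N) (show 0 < 2 * N by omega)
  generalize (2 * m + N) / (2 * N) = q at *
  have : |m - q * N| * 2 = |2 * m - 2 * N * q| := by
    rw [show 2 * m - 2 * N * q = (m - q * N) * 2 by ring, abs_mul, abs_two]
  rw [mul_comm, this, abs_le]
  constructor <;> linarith

theorem abs_add_add_abs_sub (a b : ℤ) : |a + b| + |a - b| = 2 * max |a| |b| := by
  grind

theorem abs_mul_add_mul_le {p q c d M : ℤ} (hp : 2 * |p| ≤ M) (hq : 2 * |q| ≤ M) :
    2 * |p * c + q * d| ≤ M * (|c| + |d|) := by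
  have := abs_add_le (p * c) (q * d)
  rw [abs_mul, abs_mul] at this
  nlinarith [mul_le_mul_of_nonneg_right hp (abs_nonneg c),
    mul_le_mul_of_nonneg_right hq (abs_nonneg d)]

/-- Every class modulo `b` has a representative in the square spanned by `b` and `ib`, centered
at the origin. -/
theorem exists_sub_mul_mem_square (z : GaussianInt) {b : GaussianInt} (hb : b ≠ 0) :
    ∃ q, 2 * |(z - q * b).re| ≤ |b.re| + |b.im| ∧ 2 * |(z - q * b).im| ≤ |b.re| + |b.im| ∧
      |(z - q * b).re| + |(z - q * b).im| ≤ max |b.re| |b.im| ∧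
      (¬ 2 ∣ b.re + b.im → |(z - q * b).re| + |(z - q * b).im| < max |b.re| |b.im|) := by
  have hN : 0 < b.re ^ 2 + b.im ^ 2 := by
    rw [← norm_eq_sq_add_sq]; exact GaussianInt.norm_pos.2 hb
  -- s + it is z * star b / N rounded coordinatewise. Below, p + iq is the residue times `star b`,
  -- so multiplying it by b gives N(x + iy).
  obtain ⟨s, hs⟩ := exists_mul_sub_abs_le (z.re * b.re + z.im * b.im) hN
  obtain ⟨t, ht⟩ := exists_mul_sub_abs_le (z.im * b.re - z.re * b.im) hN
  refine ⟨⟨s, t⟩, ?_⟩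
  simp only [Zsqrtd.re_sub, Zsqrtd.im_sub, Zsqrtd.re_mul, Zsqrtd.im_mul]
  set N := b.re ^ 2 + b.im ^ 2 with hNdef
  set x := z.re - (s * b.re + -1 * t * b.im) with hx
  set y := z.im - (s * b.im + t * b.re) with hy
  set p := z.re * b.re + z.im * b.im - s * N with hp
  set q := z.im * b.re - z.re * b.im - t * N with hq
  have ex : N * x = p * b.re + q * (-b.im) := by rw [hp, hq, hx, hNdef]; ring
  have ey : N * y = p * b.im + q * b.re := by rw [hp, hq, hy, hNdef]; ring
  -- M is kept free: M = N gives the weak bounds; for odd N one may take M = N - 1, which gives the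
  -- strict one.
  have key : ∀ w c d : ℤ, N * w = p * c + q * d → ∀ M, 2 * |p| ≤ M → 2 * |q| ≤ M →
      N * (2 * |w|) ≤ M * (|c| + |d|) := by
    intro w c d hw M h1 h2
    have := abs_mul_add_mul_le (c := c) (d := d) h1 h2
    rw [← hw, abs_mul, abs_of_pos hN] at this
    linarith
  have ea : ∀ M, 2 * |p| ≤ M → 2 * |q| ≤ M →
      N * (|x| + |y|) ≤ M * max |b.re| |b.im| := by
    intro M h1 h2
    have k1 := key (x + y) (b.re + b.im) (b.re - b.im) (by rw [mul_add, ex, ey]; ring) M h1 h2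
    have k2 := key (x - y) (b.re - b.im) (-(b.re + b.im)) (by rw [mul_sub, ex, ey]; ring) M h1 h2
    rw [abs_neg, add_comm |b.re - b.im|] at k2
    rw [abs_add_add_abs_sub] at k1 k2
    have : |x| + |y| = |x + y| ∨ |x| + |y| = |x - y| := by grind
    rcases this with h | h <;> rw [h] <;> linarith
  refine ⟨?_, ?_, ?_, ?_⟩
  · have := key x _ _ ex N hs ht
    rw [abs_neg] at this
    exact le_of_mul_le_mul_left this hN
  · have := key y _ _ ey N hs ht
    rw [add_comm |b.im|] at this
    exact le_of_mul_le_mul_left this hN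
  · exact le_of_mul_le_mul_left (ea N hs ht) hN
  · intro hodd
    have hNodd : ¬ 2 ∣ N := by
      intro h
      apply hodd
      have : 2 ∣ (b.re + b.im) ^ 2 := by
        rw [show (b.re + b.im) ^ 2 = N + 2 * (b.re * b.im) by rw [hNdef]; ring]
        exact dvd_add h (dvd_mul_right _ _)
      exact Int.prime_two.dvd_of_dvd_pow this
    have h3 := ea (N - 1) (by omega) (by omega)
    have hmax : 0 < max |b.re| |b.im| := by
      by_contra hle
      have h1 := le_max_left |b.re| |b.im|
      have h2 := le_max_right |b.re| |b.im|
      have := abs_nonneg b.re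
      have := abs_nonneg b.im
      have g1 : b.re = 0 := abs_eq_zero.1 (by omega)
      have g2 : b.im = 0 := abs_eq_zero.1 (by omega)
      exact hb (by ext <;> simp [g1, g2])
    refine lt_of_mul_lt_mul_left ?_ hN.le
    nlinarith

/-- The exceptional case W = 3 * 2^k, P = 2^(k+1), in which P does not divide W. The size bounds
leave only r = iP. -/
theorem sub_mem_octagon_of_sector' {W V P a b x y : ℤ} (hb : 0 ≤ b) (hba : b ≤ a) (hx : -y ≤ x)
    (hxy : x ≤ y) (ha : a ≤ V - 2) (hab : a + b ≤ 2 * W - 3) (hsq : 2 * y ≤ a + b)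
    (hsum : x + y ≤ a) (hsum' : y - x ≤ a) (hPx : P ∣ x) (hPy : P ∣ y) (hr : ¬ (x = 0 ∧ y = 0))
    (hV : V = 2 * P) (hW : 2 * W = 3 * P) :
    |x + b| ≤ W - 2 ∧ |y - a| ≤ W - 2 ∧ |x + b| + |y - a| ≤ V - 3 := by
  have hy0 : y ≠ 0 := by omega
  have hy : y = P := by
    have := Int.le_of_dvd (by omega) hPy
    exact eq_of_dvd_sub_of_lt (dvd_sub hPy dvd_rfl) (by omega) (by omega)
  have hx0 : x = 0 := eq_of_dvd_sub_of_lt (dvd_sub hPx (dvd_zero P)) (by omega) (by omega)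
  apply abs_bounds_of_linear <;> omega

theorem re_I_mul (z : GaussianInt) : ((⟨0, 1⟩ : GaussianInt) * z).re = -z.im := by
  simp [Zsqrtd.re_mul]

theorem im_I_mul (z : GaussianInt) : ((⟨0, 1⟩ : GaussianInt) * z).im = z.re := by
  simp [Zsqrtd.im_mul]

/-- Symmetry reduction: b and r may be rotated by i independently, but conjugated only together.
Rotations bring both into quarter-plane sectors; the conjugation then halves the sector of b. -/
theorem gaussianInt_sector_induction {Q : GaussianInt → GaussianInt → Prop}
    (hl : ∀ b r, Q (⟨0, 1⟩ * b) r → Q b r) (hr : ∀ b r, Q b (⟨0, 1⟩ * r) → Q b r)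
    (hs : ∀ b r, Q (star b) (star r) → Q b r)
    (h : ∀ b r, 0 ≤ b.im → b.im ≤ b.re → -r.im ≤ r.re → r.re ≤ r.im → Q b r) (b r) : Q b r := by
  have h1 : ∀ b r, -b.re ≤ b.im → b.im ≤ b.re → -r.im ≤ r.re → r.re ≤ r.im → Q b r := by
    intro b r h1 h2 h3 h4
    rcases le_total 0 b.im with h0 | h0
    · exact h b r h0 h2 h3 h4
    · apply hs
      -- Conjugation moved r to the opposite sector; two quarter turns bring it back.
      apply hr
      apply hr
      apply h <;>
        (try simp only [re_I_mul, im_I_mul, Zsqrtd.re_star, Zsqrtd.im_star]) <;> omega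
  have h2 : ∀ b r, -b.re ≤ b.im → b.im ≤ b.re → Q b r := by
    intro b r g1 g2
    by_cases c1 : -r.im ≤ r.re ∧ r.re ≤ r.im
    · exact h1 b r g1 g2 c1.1 c1.2
    apply hr
    by_cases c2 : -r.re ≤ r.im ∧ r.im ≤ r.re
    · apply h1 <;> (try simp only [re_I_mul, im_I_mul]) <;> omega
    apply hr
    by_cases c3 : r.im ≤ r.re ∧ r.re ≤ -r.im
    · apply h1 <;> (try simp only [re_I_mul, im_I_mul]) <;> omega
    apply hr
    apply h1 <;> (try simp only [re_I_mul, im_I_mul]) <;> omega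
  by_cases c1 : -b.re ≤ b.im ∧ b.im ≤ b.re
  · exact h2 b r c1.1 c1.2
  apply hl
  by_cases c2 : b.im ≤ b.re ∧ b.re ≤ -b.im
  · apply h2 <;> (try simp only [re_I_mul, im_I_mul]) <;> omega
  apply hl
  by_cases c3 : b.re ≤ b.im ∧ b.im ≤ -b.re
  · apply h2 <;> (try simp only [re_I_mul, im_I_mul]) <;> omega
  apply hl
  apply h2 <;> (try simp only [re_I_mul, im_I_mul]) <;> omega

theorem exists_unit_sub_mul_mem_octagon {n : ℕ} {P : ℤ}
    (hP : 2 ≤ P) (h2V : 2 ∣ octWidth (n + 1))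
    (hconst : (octWidth n + P ≤ octWidth (n + 1) ∧ octWidth (n + 1) + P ≤ 2 * octWidth n ∧
      (octWidth (n + 1) + 2 * P ≤ 2 * octWidth n ∨ octWidth n = 2 * P) ∧
      P ∣ octWidth n ∧ P ∣ octWidth (n + 1)) ∨
      (octWidth (n + 1) = 2 * P ∧ 2 * octWidth n = 3 * P)) (b r : GaussianInt) :
    max |b.re| |b.im| ≤ octWidth (n + 1) - 2 ∧ |b.re| + |b.im| ≤ 2 * octWidth n - 3 ∧
    (¬ 2 ∣ b.re + b.im ∨ max |b.re| |b.im| ≤ octWidth (n + 1) - 3) ∧ (2 ∣ r.re ∧ 2 ∣ r.im) ∧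
    (2 * |r.re| ≤ |b.re| + |b.im| ∧ 2 * |r.im| ≤ |b.re| + |b.im| ∧
      |r.re| + |r.im| ≤ max |b.re| |b.im|) ∧ (P ∣ r.re ∧ P ∣ r.im) ∧
    ¬ (r.re = 0 ∧ r.im = 0) ∧
    ¬ (|r.re| ≤ octWidth n - 2 * P ∧ |r.im| ≤ octWidth n - 2 * P ∧
      |r.re| + |r.im| ≤ octWidth (n + 1) - 3 * P) →
    ∃ u, IsUnit u ∧ r - u * b ∈ octagon n := by
  induction b, r using gaussianInt_sector_induction with
  | hl b r h =>
    rintro ⟨h1, h2, h3, h4, h5, h6, h7, h8⟩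
    simp only [re_I_mul, im_I_mul, abs_neg] at h
    rw [max_comm |b.im|, add_comm |b.im|] at h
    obtain ⟨u, hu, hm⟩ := h ⟨h1, h2, by omega, h4, h5, h6, h7, h8⟩
    exact ⟨u * ⟨0, 1⟩, hu.mul isUnit_I, by rwa [mul_assoc]⟩
  | hr b r h =>
    rintro ⟨h1, h2, h3, h4, ⟨h5, h5', h5''⟩, ⟨h6, h6'⟩, h7, h8⟩
    simp only [re_I_mul, im_I_mul, abs_neg, dvd_neg] at h
    obtain ⟨u, hu, hm⟩ := h ⟨h1, h2, h3, by omega, ⟨h5', h5, by omega⟩, ⟨h6', h6⟩, by omega,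
      by omega⟩
    refine ⟨-⟨0, 1⟩ * u, isUnit_I.neg.mul hu, ?_⟩
    rw [← unit_mul_mem_octagon isUnit_I]
    convert hm using 1
    have : (⟨0, 1⟩ * ⟨0, 1⟩ : GaussianInt) = -1 := by
      ext <;> simp [Zsqrtd.re_mul, Zsqrtd.im_mul]
    linear_combination u * b * this
  | hs b r h =>
    rintro ⟨h1, h2, h3, h4, h5, h6, h7, h8⟩
    simp only [Zsqrtd.re_star, Zsqrtd.im_star, abs_neg, dvd_neg, neg_eq_zero] at h
    obtain ⟨u, hu, hm⟩ := h ⟨h1, h2, by omega, h4, h5, h6, h7, h8⟩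
    refine ⟨star u, hu.star, ?_⟩
    have hstar : star (r - star u * b) = star r - u * star b := by simp [mul_comm]
    rw [← hstar] at hm
    simpa only [octagon, Set.mem_ofPred_eq, Zsqrtd.re_star, Zsqrtd.im_star, abs_neg] using hm
  | h b r g1 g2 g3 g4 =>
    rintro ⟨h1, h2, h3, h4, ⟨h5, h5', h5''⟩, h6, h7, h8⟩
    have hbre : |b.re| = b.re := abs_of_nonneg (by omega)
    have hbim : |b.im| = b.im := abs_of_nonneg g1
    have hrim : |r.im| = r.im := abs_of_nonneg (by omega)
    have hrre := abs_cases r.re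
    simp only [hbre, hbim, hrim, max_eq_left g2] at h1 h2 h3 h5 h5' h5'' h8
    have key : (|r.re - b.re| ≤ octWidth n - 2 ∧ |r.im - b.im| ≤ octWidth n - 2 ∧
        |r.re - b.re| + |r.im - b.im| ≤ octWidth (n + 1) - 3) ∨
        (|r.re + b.im| ≤ octWidth n - 2 ∧ |r.im - b.re| ≤ octWidth n - 2 ∧
        |r.re + b.im| + |r.im - b.re| ≤ octWidth (n + 1) - 3) := by
      rcases hconst with ⟨c1, c2, c3, c4, c5⟩ | ⟨c1, c2⟩
      · exact sub_mem_octagon_of_sector g1 g2 g3 g4 hP h1 h2 h3 h4.1 h4.2 h2V (by omega)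
          (by omega) (by omega) c1 c2 c3 c4 c5 h6.1 h6.2 (by omega)
      · exact Or.inr (sub_mem_octagon_of_sector' g1 g2 g3 g4 h1 h2 (by omega) (by omega)
          (by omega) h6.1 h6.2 h7 c1 c2)
    rcases key with h | h
    · exact ⟨1, isUnit_one, by simpa [octagon] using h⟩
    · refine ⟨⟨0, 1⟩, isUnit_I, ?_⟩
      simpa [octagon, re_I_mul, im_I_mul] using h

theorem exists_eq_two_pow_mul {z : GaussianInt} (hz : z ≠ 0) :
    ∃ (j : ℕ) (y : GaussianInt), y ∈ notDivTwo ∧ z = 2 ^ j * y := by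
  obtain ⟨y, h, hy⟩ := (FiniteMultiplicity.of_not_isUnit (a := (2 : GaussianInt)) (by
    rw [gaussianInt_isUnit_iff]; decide) hz).exists_eq_pow_mul_and_not_dvd
  refine ⟨_, y, ?_, h⟩
  by_contra hc
  obtain ⟨c, rfl⟩ := exists_eq_two_mul hc
  exact hy (dvd_mul_right _ _)

theorem re_two_pow_mul (j : ℕ) (z : GaussianInt) : (2 ^ j * z).re = 2 ^ j * z.re := by
  induction j with
  | zero => simp
  | succ j ih => rw [pow_succ', mul_assoc, re_two_mul, ih]; ring

theorem im_two_pow_mul (j : ℕ) (z : GaussianInt) : (2 ^ j * z).im = 2 ^ j * z.im := by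
  induction j with
  | zero => simp
  | succ j ih => rw [pow_succ', mul_assoc, im_two_mul, ih]; ring

/-- If the coordinates have even sum but are not both even, they are both odd, and so cannot attain
the even bound w_{n+1} - 2. -/
theorem notDivTwo_parity {n : ℕ} {b : GaussianInt} (hb : b ∈ notDivTwo)
    (ho : b ∈ octagon (n + 1)) :
    ¬ 2 ∣ b.re + b.im ∨ max |b.re| |b.im| ≤ octWidth (n + 1) - 3 := by
  obtain ⟨h1, h2, -⟩ := ho
  have h2V := (octWidth_bounds n).2.2.2
  simp only [notDivTwo, Set.mem_ofPred_eq] at hb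
  grind

theorem exists_unit_sub_mul_mem_octSet {n : ℕ} {b r : GaussianInt} (hb : b ∈ notDivTwo)
    (ho : b ∈ octagon (n + 1))
    (hsq : 2 * |r.re| ≤ |b.re| + |b.im| ∧ 2 * |r.im| ≤ |b.re| + |b.im| ∧
      |r.re| + |r.im| ≤ max |b.re| |b.im|)
    (hr : r ∉ notDivTwo) (hrn : r ∉ octSet n) : ∃ u, r - u * b ∈ octSet n := by
  have hpar := notDivTwo_parity hb ho
  obtain ⟨h1, h2, h3⟩ := ho
  have h2V := (octWidth_bounds n).2.2.2
  rw [show n + 1 + 1 = n + 2 by ring, octWidth_add_two] at h3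
  have hr0 : r ≠ 0 := fun h => hrn (h ▸ zero_mem_octSet n)
  obtain ⟨j, y, hy, hry⟩ := exists_eq_two_pow_mul hr0
  have hj : j ≠ 0 := by
    rintro rfl
    rw [pow_zero, one_mul] at hry
    exact hr (hry ▸ hy)
  have hP : (2 : ℤ) ≤ 2 ^ j := le_self_pow₀ one_le_two hj
  have hre : r.re = 2 ^ j * y.re := by rw [hry, re_two_pow_mul]
  have him : r.im = 2 ^ j * y.im := by rw [hry, im_two_pow_mul]
  have hd1 : (2 : ℤ) ^ j ∣ r.re := Dvd.intro _ hre.symm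
  have hd2 : (2 : ℤ) ^ j ∣ r.im := Dvd.intro _ him.symm
  have hr0' : ¬ (r.re = 0 ∧ r.im = 0) := fun h => hr0 (by ext <;> simp [h.1, h.2])
  have hbd : ¬ (|r.re| ≤ octWidth n - 2 * 2 ^ j ∧ |r.im| ≤ octWidth n - 2 * 2 ^ j ∧
      |r.re| + |r.im| ≤ octWidth (n + 1) - 3 * 2 ^ j) := by
    rintro ⟨g1, g2, g3⟩
    have hpos : |(2 : ℤ) ^ j| = 2 ^ j := abs_of_pos (by positivity)
    rw [hre, abs_mul, hpos] at g1 g3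
    rw [him, abs_mul, hpos] at g2 g3
    exact hrn (hry ▸ two_pow_mul_mem_octSet j n y hy g1 g2 (by rw [mul_add]; exact g3))
  have hlt : (2 : ℤ) ^ j < octWidth n := by
    by_contra hle
    refine hr0' ⟨?_, ?_⟩
    · exact Int.eq_zero_of_abs_lt_dvd hd1 (by omega)
    · exact Int.eq_zero_of_abs_lt_dvd hd2 (by omega)
  have hconst : (octWidth n + 2 ^ j ≤ octWidth (n + 1) ∧
      octWidth (n + 1) + 2 ^ j ≤ 2 * octWidth n ∧
      (octWidth (n + 1) + 2 * 2 ^ j ≤ 2 * octWidth n ∨ octWidth n = 2 * 2 ^ j) ∧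
      (2 : ℤ) ^ j ∣ octWidth n ∧ (2 : ℤ) ^ j ∣ octWidth (n + 1)) ∨
      (octWidth (n + 1) = 2 * 2 ^ j ∧ 2 * octWidth n = 3 * 2 ^ j) := by
    obtain ⟨k, hk⟩ := octWidth_cases n
    -- Since 2^j < w_n ≤ 4 * 2^k. The value j = k + 1 is exceptional when w_n = 3 * 2^k, and gives
    -- w_n = 2P when w_n = 4 * 2^k.
    have hjk : j < k + 2 := by
      by_contra hle
      have : (2 : ℤ) ^ (k + 2) ≤ 2 ^ j := pow_le_pow_right₀ one_le_two (by omega)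
      rw [pow_add] at this
      have : (1 : ℤ) ≤ 2 ^ k := one_le_pow₀ one_le_two
      omega
    rcases Nat.lt_or_ge k j with hkj | hkj
    · obtain rfl : j = k + 1 := by omega
      have e : (2 : ℤ) ^ (k + 1) = 2 * 2 ^ k := pow_succ' _ _
      rcases hk with ⟨e1, e2⟩ | ⟨e1, e2⟩
      · right; omega
      · left
        refine ⟨by omega, by omega, by omega, ⟨2, by omega⟩, ⟨3, by omega⟩⟩
    · have hd : (2 : ℤ) ^ j ∣ 2 ^ k := pow_dvd_pow 2 hkj
      have hle : (2 : ℤ) ^ j ≤ 2 ^ k := Int.le_of_dvd (by positivity) hd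
      left
      rcases hk with ⟨e1, e2⟩ | ⟨e1, e2⟩ <;> rw [e1, e2] <;>
        exact ⟨by omega, by omega, by omega, hd.mul_left _, hd.mul_left _⟩
  have hr' : 2 ∣ r.re ∧ 2 ∣ r.im := not_not.1 hr
  obtain ⟨u, hu, hm⟩ := exists_unit_sub_mul_mem_octagon hP h2V hconst b r
    ⟨max_le h1 h2, h3, hpar, hr', hsq, ⟨hd1, hd2⟩, hr0', hbd⟩
  refine ⟨u, mem_octSet_of_mem_octagon ?_ hm⟩
  obtain ⟨c, rfl⟩ := exists_eq_two_mul hr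
  have := add_two_mul_mem_notDivTwo (z := c) ((unit_mul_mem_notDivTwo hu.neg).2 hb)
  rwa [neg_mul, neg_add_eq_sub] at this

theorem exists_sub_mul_mem_octSet_of_notDivTwo {n : ℕ} {b : GaussianInt} (hb : b ∈ notDivTwo)
    (ho : b ∈ octagon (n + 1)) (z : GaussianInt) : ∃ q, z - q * b ∈ octSet n := by
  obtain ⟨q, h1, h2, h3, h4⟩ := exists_sub_mul_mem_square z (ne_zero_of_mem_notDivTwo hb)
  by_cases hr : z - q * b ∈ notDivTwo
  · refine ⟨q, mem_octSet_of_mem_octagon hr ?_⟩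
    have hpar := notDivTwo_parity hb ho
    obtain ⟨g1, g2, g3⟩ := ho
    have hm := max_le g1 g2
    rw [show n + 1 + 1 = n + 2 by ring, octWidth_add_two] at g3
    refine ⟨by omega, by omega, ?_⟩
    -- The missing 1 in the bound w_{n+1} - 3 comes from the parity of b, or else from the strict
    -- inequality `h4`.
    by_cases h : 2 ∣ b.re + b.im
    · have := hpar.resolve_left (not_not.2 h)
      omega
    · have := h4 h
      omega
  · by_cases hrn : z - q * b ∈ octSet n
    · exact ⟨q, hrn⟩
    · obtain ⟨u, hu⟩ := exists_unit_sub_mul_mem_octSet hb ho ⟨h1, h2, h3⟩ hr hrn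
      exact ⟨q + u, by rwa [add_mul, ← sub_sub]⟩

theorem exists_sub_mul_mem_octSet (n : ℕ) {b : GaussianInt} (hb0 : b ≠ 0)
    (hb : b ∈ octSet (n + 1)) (z : GaussianInt) : ∃ q, z - q * b ∈ octSet n := by
  induction n using Nat.strong_induction_on generalizing b z with
  | _ n ih =>
  by_cases hb2 : b ∈ notDivTwo
  · exact exists_sub_mul_mem_octSet_of_notDivTwo hb2 (octSet_subset_octagon _ hb) z
  obtain ⟨c, rfl⟩ := exists_eq_two_mul hb2
  have hc0 : c ≠ 0 := right_ne_zero_of_mul hb0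
  rcases n with _ | n
  · exact absurd (eq_zero_of_two_mul_mem_octSet one_lt_two hb) hc0
  have hco : c ∈ octSet n := two_mul_mem_octSet_iff.1 hb
  obtain ⟨q, h1, h2, h3, -⟩ := exists_sub_mul_mem_square z hb0
  by_cases hr : z - q * (2 * c) ∈ notDivTwo
  · refine ⟨q, mem_octSet_of_mem_octagon hr ?_⟩
    obtain ⟨g1, g2, g3⟩ := octSet_subset_octagon _ hco
    have e1 := octWidth_add_two n
    have e2 := octWidth_add_two (n + 1)
    have hw := octWidth_bounds (n + 1)
    simp only [re_two_mul c, im_two_mul c, abs_mul, abs_two] at h1 h2 h3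
    have hm := max_le g1 g2
    rw [← mul_max_of_nonneg _ _ zero_le_two] at h3
    refine ⟨by omega, by omega, ?_⟩
    rw [e1]
    omega
  · obtain ⟨y, hy⟩ := exists_eq_two_mul hr
    suffices h : ∃ s, 2 * (y - s * c) ∈ octSet (n + 1) by
      obtain ⟨s, hs⟩ := h
      refine ⟨q + s, ?_⟩
      convert hs using 1
      linear_combination hy
    rcases n with _ | n
    · rw [mem_octSet_zero_iff] at hco
      obtain ⟨v, rfl⟩ := hco.resolve_left hc0
      exact ⟨y * ↑v⁻¹, by simpa using zero_mem_octSet 1⟩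
    · obtain ⟨s, hs⟩ := ih n (by omega) hc0 hco y
      exact ⟨s, two_mul_mem_octSet_iff.2 hs⟩

/-- The Motzkin sets of `ℤ[i]`. -/
theorem motzkinSet_gaussianInt (n : ℕ) : motzkinSet GaussianInt n = octSet n := by
  induction n with
  | zero => ext z; simp [motzkinSet, mem_octSet_zero_iff]
  | succ n ih =>
    rw [motzkinSet, ih]
    apply Set.Subset.antisymm
    · exact Set.union_subset (octSet_mono n) fun b hb => mem_octSet_succ_of_surjects hb
    · intro b hb
      by_cases hb0 : b = 0
      · exact Or.inl (hb0 ▸ zero_mem_octSet n)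
      right
      intro x
      obtain ⟨z, rfl⟩ := Ideal.Quotient.mk_surjective x
      obtain ⟨q, hq⟩ := exists_sub_mul_mem_octSet n hb0 hb z
      refine ⟨_, hq, ?_⟩
      rw [Ideal.Quotient.eq, Ideal.mem_span_singleton]
      exact ⟨-q, by ring⟩

/-! ### Counting lattice points in octagons -/

theorem sum_Icc_neg_succ (F : ℤ → ℤ) (N : ℕ) :
    ∑ x ∈ Finset.Icc (-((N + 1 : ℕ) : ℤ)) ((N + 1 : ℕ) : ℤ), F x =
      ∑ x ∈ Finset.Icc (-(N : ℤ)) N, F x + (F (N + 1) + F (-(N + 1))) := by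
  have : Finset.Icc (-((N + 1 : ℕ) : ℤ)) ((N + 1 : ℕ) : ℤ) =
      insert ((N : ℤ) + 1) (insert (-((N : ℤ) + 1)) (Finset.Icc (-(N : ℤ)) N)) := by
    ext x
    simp only [Finset.mem_Icc, Finset.mem_insert]
    omega
  rw [this, Finset.sum_insert, Finset.sum_insert]
  · ring
  · simp only [Finset.mem_Icc]; omega
  · simp only [Finset.mem_Icc, Finset.mem_insert]; omega

theorem sum_Icc_min_of_le (d e N : ℕ) (h : N ≤ d) :
    ∑ x ∈ Finset.Icc (-(N : ℤ)) N, (2 * min ((d : ℤ) + e) (2 * d + e - |x|) + 1) =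
      (2 * N + 1) * (2 * (d + e) + 1) := by
  induction N with
  | zero => simp; omega
  | succ N ih =>
    rw [sum_Icc_neg_succ, ih (by omega), abs_neg, abs_of_nonneg (by positivity),
      min_eq_left (by omega)]
    push_cast
    ring

theorem sum_Icc_min (d e i : ℕ) :
    ∑ x ∈ Finset.Icc (-((d + i : ℕ) : ℤ)) ((d + i : ℕ) : ℤ),
      (2 * min ((d : ℤ) + e) (2 * d + e - |x|) + 1) =
      (2 * d + 1) * (2 * (d + e) + 1) + 2 * (i * (2 * (d + e) + 1) - i * (i + 1)) := by
  induction i with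
  | zero => rw [add_zero, sum_Icc_min_of_le d e d le_rfl]; simp
  | succ i ih =>
    rw [← add_assoc, sum_Icc_neg_succ, ih, abs_neg, abs_of_nonneg (by positivity),
      min_eq_right (by push_cast; omega)]
    push_cast
    ring

/-- A square of side 2(d + e) + 1 loses four corner triangles of e(e + 1)/2 points each. The proof
sums over columns. -/
theorem card_filter_abs_add_abs_le (d e : ℕ) :
    ((((Finset.Icc (-((d + e : ℕ) : ℤ)) ((d + e : ℕ) : ℤ)) ×ˢ
      (Finset.Icc (-((d + e : ℕ) : ℤ)) ((d + e : ℕ) : ℤ))).filter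
        fun p : ℤ × ℤ => |p.1| + |p.2| ≤ 2 * d + e).card : ℤ) =
      (2 * (d + e) + 1) ^ 2 - 2 * e * (e + 1) := by
  rw [Finset.card_filter, Finset.sum_product, Nat.cast_sum]
  trans ∑ x ∈ Finset.Icc (-((d + e : ℕ) : ℤ)) ((d + e : ℕ) : ℤ),
      (2 * min ((d : ℤ) + e) (2 * d + e - |x|) + 1)
  · refine Finset.sum_congr rfl fun x hx => ?_
    rw [← Finset.card_filter]
    have hx' : |x| ≤ d + e := by
      rw [Finset.mem_Icc] at hx
      exact abs_le.2 (by push_cast at hx; exact hx)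
    have : (Finset.Icc (-((d + e : ℕ) : ℤ)) ((d + e : ℕ) : ℤ)).filter
        (fun y => |x| + |y| ≤ 2 * d + e) =
        Finset.Icc (-min ((d : ℤ) + e) (2 * d + e - |x|)) (min ((d : ℤ) + e) (2 * d + e - |x|)) := by
      ext y
      rw [Finset.mem_filter, Finset.mem_Icc, Finset.mem_Icc]
      rcases abs_cases y with h | h <;> push_cast <;> omega
    rw [this, Int.card_Icc]
    omega
  · rw [sum_Icc_min]
    ring

/-- The integer points of the octagon `|x|, |y| ≤ M`, `|x| + |y| ≤ L`. -/
def octRegion (M L : ℤ) : Set GaussianInt :=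
  {z | |z.re| ≤ M ∧ |z.im| ≤ M ∧ |z.re| + |z.im| ≤ L}

theorem octRegion_eq_image (d e : ℕ) : octRegion (d + e) (2 * d + e) =
    (fun p : ℤ × ℤ => (⟨p.1, p.2⟩ : GaussianInt)) '' ↑(((Finset.Icc (-((d + e : ℕ) : ℤ))
      ((d + e : ℕ) : ℤ)) ×ˢ (Finset.Icc (-((d + e : ℕ) : ℤ)) ((d + e : ℕ) : ℤ))).filter
        fun p : ℤ × ℤ => |p.1| + |p.2| ≤ 2 * d + e) := by
  ext z
  simp only [octRegion, Set.mem_ofPred_eq, Set.mem_image, SetLike.mem_coe, Finset.mem_filter,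
    Finset.mem_product, Finset.mem_Icc, abs_le]
  constructor
  · rintro ⟨h1, h2, h3⟩
    exact ⟨(z.re, z.im), by push_cast; exact ⟨⟨h1, h2⟩, h3⟩, rfl⟩
  · rintro ⟨p, ⟨⟨h1, h2⟩, h3⟩, rfl⟩
    push_cast at h1 h2
    exact ⟨h1, h2, h3⟩

theorem finite_and_ncard_octRegion {M L : ℤ} (h1 : M ≤ L) (h2 : L ≤ 2 * M) :
    (octRegion M L).Finite ∧
    ((octRegion M L).ncard : ℤ) = (2 * M + 1) ^ 2 - 2 * (2 * M - L) * (2 * M - L + 1) := by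
  obtain ⟨d, hd⟩ := Int.eq_ofNat_of_zero_le (sub_nonneg.2 h1)
  obtain ⟨e, he⟩ := Int.eq_ofNat_of_zero_le (sub_nonneg.2 h2)
  obtain rfl : M = d + e := by omega
  obtain rfl : L = 2 * d + e := by omega
  rw [octRegion_eq_image]
  refine ⟨(Finset.finite_toSet _).image _, ?_⟩
  rw [Set.ncard_image_of_injective, Set.ncard_coe_finset, card_filter_abs_add_abs_le]
  · ring
  · rintro ⟨a, b⟩ ⟨c, d⟩ h
    simpa [Zsqrtd.ext_iff] using h

theorem octagon_eq_octRegion (n : ℕ) :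
    octagon n = octRegion (octWidth n - 2) (octWidth (n + 1) - 3) := rfl

theorem octagon_finite (n : ℕ) : (octagon n).Finite := by
  have := octWidth_bounds n
  rw [octagon_eq_octRegion]
  exact (finite_and_ncard_octRegion (by omega) (by omega)).1

theorem octSet_finite (n : ℕ) : (octSet n).Finite :=
  (octagon_finite n).subset (octSet_subset_octagon n)

/-- M' and L' are the halves of M and L rounded down, so the points divisible by 2 are the doubles
of the smaller region. -/
theorem ncard_notDivTwo_inter_octRegion {M L M' L' : ℤ} (h1 : M ≤ L) (h2 : L ≤ 2 * M)
    (h1' : M' ≤ L') (h2' : L' ≤ 2 * M') (hM : M = 2 * M' ∨ M = 2 * M' + 1)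
    (hL : L = 2 * L' ∨ L = 2 * L' + 1) :
    ((notDivTwo ∩ octRegion M L).ncard : ℤ) =
      (2 * M + 1) ^ 2 - 2 * (2 * M - L) * (2 * M - L + 1) -
      ((2 * M' + 1) ^ 2 - 2 * (2 * M' - L') * (2 * M' - L' + 1)) := by
  obtain ⟨hf, hc⟩ := finite_and_ncard_octRegion h1 h2
  obtain ⟨hf', hc'⟩ := finite_and_ncard_octRegion h1' h2'
  have hsub : (fun z => 2 * z) '' octRegion M' L' ⊆ octRegion M L := by
    rintro _ ⟨z, ⟨g1, g2, g3⟩, rfl⟩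
    simp only [octRegion, Set.mem_ofPred_eq, re_two_mul, im_two_mul, abs_mul, abs_two]
    omega
  have heq : notDivTwo ∩ octRegion M L = octRegion M L \ (fun z => 2 * z) '' octRegion M' L' := by
    ext z
    constructor
    · rintro ⟨h, hz⟩
      refine ⟨hz, ?_⟩
      rintro ⟨y, -, rfl⟩
      exact two_mul_notMem_notDivTwo y h
    · rintro ⟨hz, h⟩
      refine ⟨?_, hz⟩
      by_contra hn
      obtain ⟨y, rfl⟩ := exists_eq_two_mul hn
      refine h ⟨y, ?_, rfl⟩
      simp only [octRegion, Set.mem_ofPred_eq, re_two_mul, im_two_mul, abs_mul, abs_two] at hz ⊢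
      omega
  have := Set.ncard_sdiff_add_ncard_of_subset hsub hf
  rw [← heq, Set.ncard_image_of_injective _ two_mul_injective] at this
  rw [← hc, ← hc', ← this]
  push_cast
  ring

theorem ncard_notDivTwo_inter_octagon_even (k : ℕ) :
    ((notDivTwo ∩ octagon (2 * k + 2)).ncard : ℤ) = 84 * 4 ^ k - 48 * 2 ^ k + 8 := by
  have ht : (1 : ℤ) ≤ 2 ^ k := one_le_pow₀ one_le_two
  rw [octagon_eq_octRegion, octWidth_add_two, octWidth_two_mul, octWidth_add_two (2 * k + 1),
    octWidth_two_mul_add_one, ncard_notDivTwo_inter_octRegion (M' := 3 * 2 ^ k - 1)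
      (L' := 4 * 2 ^ k - 2) (by omega) (by omega) (by omega) (by omega) (by omega) (by omega),
    show (4 : ℤ) ^ k = (2 ^ k) ^ 2 by rw [← pow_mul, mul_comm, pow_mul]; norm_num]
  ring

theorem ncard_notDivTwo_inter_octagon_odd (k : ℕ) :
    ((notDivTwo ∩ octagon (2 * k + 1)).ncard : ℤ) = 42 * 4 ^ k - 34 * 2 ^ k + 8 := by
  have ht : (1 : ℤ) ≤ 2 ^ k := one_le_pow₀ one_le_two
  rw [octagon_eq_octRegion, octWidth_two_mul_add_one, octWidth_add_two, octWidth_two_mul,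
    ncard_notDivTwo_inter_octRegion (M' := 2 * 2 ^ k - 1)
      (L' := 3 * 2 ^ k - 2) (by omega) (by omega) (by omega) (by omega) (by omega) (by omega),
    show (4 : ℤ) ^ k = (2 ^ k) ^ 2 by rw [← pow_mul, mul_comm, pow_mul]; norm_num]
  ring

/-! ### Cardinalities of the Motzkin sets and of the fibers -/

theorem ncard_octSet_add_two_sdiff_zero (n : ℕ) : (octSet (n + 2) \ {0}).ncard =
    (notDivTwo ∩ octagon (n + 2)).ncard + (octSet n \ {0}).ncard := by
  have h : octSet (n + 2) \ {0} =
      (notDivTwo ∩ octagon (n + 2)) ∪ (fun z => 2 * z) '' (octSet n \ {0}) := by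
    ext z
    constructor
    · rintro ⟨h | ⟨y, hy, rfl⟩, h0⟩
      · exact Or.inl h
      · exact Or.inr ⟨y, ⟨hy, by rintro rfl; exact h0 (mul_zero _)⟩, rfl⟩
    · rintro (h | ⟨y, ⟨hy, h0⟩, rfl⟩)
      · exact ⟨Or.inl h, ne_zero_of_mem_notDivTwo h.1⟩
      · exact ⟨Or.inr ⟨y, hy, rfl⟩, mul_ne_zero two_ne_zero h0⟩
  rw [h, Set.ncard_union_eq _ ((octagon_finite _).inter_of_right _)
    ((octSet_finite n).sdiff.image _), Set.ncard_image_of_injective _ two_mul_injective]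
  rw [Set.disjoint_left]
  rintro _ ⟨h, -⟩ ⟨y, -, rfl⟩
  exact two_mul_notMem_notDivTwo y h

theorem ncard_octSet_zero_sdiff_zero : (octSet 0 \ {0}).ncard = 4 := by
  have h : octSet 0 \ {0} = ↑({⟨1, 0⟩, ⟨-1, 0⟩, ⟨0, 1⟩, ⟨0, -1⟩} : Finset GaussianInt) := by
    ext z
    simp only [Set.mem_sdiff, mem_octSet_zero_iff, Set.mem_singleton_iff, SetLike.mem_coe,
      Finset.mem_insert, Finset.mem_singleton]
    constructor
    · rintro ⟨h, h0⟩
      exact gaussianInt_isUnit_cases (h.resolve_left h0)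
    · intro h
      have hu : IsUnit z := by
        rw [gaussianInt_isUnit_iff, abs_add_abs_eq_one_iff]
        simpa only [Zsqrtd.ext_iff] using h
      exact ⟨Or.inr hu, hu.ne_zero⟩
  rw [h, Set.ncard_coe_finset]
  rfl

theorem ncard_octSet_one_sdiff_zero : ((octSet 1 \ {0}).ncard : ℤ) = 16 := by
  have h : octSet 1 \ {0} = notDivTwo ∩ octagon 1 := by
    ext z
    constructor
    · rintro ⟨h, h0⟩
      exact h.resolve_left h0
    · exact fun h => ⟨Or.inr h, ne_zero_of_mem_notDivTwo h.1⟩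
  rw [h]
  simpa using ncard_notDivTwo_inter_octagon_odd 0

theorem ncard_octSet_even_sdiff_zero (k : ℕ) :
    ((octSet (2 * k) \ {0}).ncard : ℤ) = 28 * 4 ^ k - 48 * 2 ^ k + 8 * k + 24 := by
  induction k with
  | zero => rw [mul_zero, ncard_octSet_zero_sdiff_zero]; norm_num
  | succ k ih =>
    rw [show 2 * (k + 1) = 2 * k + 2 by ring, ncard_octSet_add_two_sdiff_zero, Nat.cast_add, ih,
      ncard_notDivTwo_inter_octagon_even]
    push_cast
    ring

theorem ncard_octSet_odd_sdiff_zero (k : ℕ) :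
    ((octSet (2 * k + 1) \ {0}).ncard : ℤ) = 56 * 4 ^ k - 68 * 2 ^ k + 8 * k + 28 := by
  induction k with
  | zero => rw [mul_zero, zero_add, ncard_octSet_one_sdiff_zero]; norm_num
  | succ k ih =>
    have := ncard_notDivTwo_inter_octagon_odd (k + 1)
    rw [show 2 * (k + 1) + 1 = 2 * k + 1 + 2 by ring] at this ⊢
    rw [ncard_octSet_add_two_sdiff_zero, Nat.cast_add, ih, this]
    push_cast
    ring

theorem ncard_minimalEuclideanFunction_preimage (n : ℕ) :
    ((minimalEuclideanFunction GaussianInt ⁻¹' {n + 1}).ncard : ℤ) =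
      (octSet (n + 1) \ {0}).ncard - (octSet n \ {0}).ncard := by
  have hle : ∀ (a : {a : GaussianInt // a ≠ 0}) j,
      minimalEuclideanFunction GaussianInt a ≤ j ↔ (a : GaussianInt) ∈ octSet j := fun a j => by
    rw [minimalEuclideanFunction_le_iff isEuclideanFunction_gaussianInt_norm,
      motzkinSet_gaussianInt]
  have himage : Subtype.val '' (minimalEuclideanFunction GaussianInt ⁻¹' {n + 1}) =
      (octSet (n + 1) \ {0}) \ (octSet n \ {0}) := by
    ext z
    constructor
    · rintro ⟨a, ha, rfl⟩
      have ha' : minimalEuclideanFunction GaussianInt a = n + 1 := ha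
      refine ⟨⟨(hle a _).1 ha'.le, a.2⟩, fun h => ?_⟩
      have := (hle a n).2 h.1
      omega
    · rintro ⟨⟨h, h0⟩, h1⟩
      refine ⟨⟨z, h0⟩, ?_, rfl⟩
      have g1 := (hle ⟨z, h0⟩ _).2 h
      have g2 := mt (hle ⟨z, h0⟩ n).1 fun h => h1 ⟨h, h0⟩
      change minimalEuclideanFunction GaussianInt ⟨z, h0⟩ = n + 1
      omega
  have hsub : octSet n \ {0} ⊆ octSet (n + 1) \ {0} :=
    Set.sdiff_subset_sdiff_left (octSet_mono n)
  have := Set.ncard_sdiff_add_ncard_of_subset hsub (octSet_finite (n + 1)).sdiff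
  rw [← himage, Set.ncard_image_of_injective _ Subtype.val_injective] at this
  rw [← this]
  push_cast
  ring

theorem mainTheorem4 (k : ℕ) (hk : 1 ≤ k) :
    ((minimalEuclideanFunction GaussianInt ⁻¹' {2 * k}).ncard : ℤ)
        = 14 * 4 ^ k - 14 * 2 ^ k + 4 ∧
    ((minimalEuclideanFunction GaussianInt ⁻¹' {2 * k + 1}).ncard : ℤ)
        = 28 * 4 ^ k - 20 * 2 ^ k + 4 := by
  constructor
  · obtain ⟨m, rfl⟩ := Nat.exists_eq_add_of_le' hk
    have := ncard_octSet_even_sdiff_zero (m + 1)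
    rw [show 2 * (m + 1) = 2 * m + 1 + 1 by ring] at this ⊢
    rw [ncard_minimalEuclideanFunction_preimage, this, ncard_octSet_odd_sdiff_zero]
    push_cast
    ring
  · rw [ncard_minimalEuclideanFunction_preimage, ncard_octSet_odd_sdiff_zero,
      ncard_octSet_even_sdiff_zero]
    ring
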